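/- All graphs are finite, simple and undirected. A set $F$ of vertices of a graph $G$ is a dissociation set if the induced subgraph $G[F]$ has maximum degree at most $1$; it is a maximal dissociation set if it is not a proper subset of any other dissociation set of $G$. Let $\phi(G)$ denote the number of maximal dissociation sets of $G$. Theorem 1.2. Let $G$ be a triangle-free graph of order $n$ (that is, with $n$ vertices). Then $\phi(G)\le 6^{n/4}$. Furthermore, $\phi(G)=6^{n/4}$ if and only if $n\equiv 0\pmod 4$ and $G$ is isomorphic to $\frac{n}{4}C_4$, the disjoint union of $n/4$ copies of the cycle $C_4$ on four vertices (the graph without vertices if $n=0$). -/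

import Mathlib

namespace SimpleGraph

/-- A set `F` of vertices is a dissociation set of `G` if every vertex of the induced subgraph
`G[F]` has at most one neighbour in `G[F]`, that is, `G[F]` has maximum degree at most `1`. -/
def IsDissociationSet {V : Type*} (G : SimpleGraph V) (F : Set V) : Prop :=
  ∀ v : F, ((G.induce F).neighborSet v).encard ≤ 1

/-- The set `MD(G)` of all maximal dissociation sets of `G`: the dissociation sets that are not
properly contained in another dissociation set. -/
def maximalDissociationSets {V : Type*} (G : SimpleGraph V) : Set (Set V) :=
  {F | Maximal G.IsDissociationSet F}

/-- The number `φ(G)` of maximal dissociation sets of `G` (used for finite graphs). -/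
noncomputable def numMaximalDissociationSets {V : Type*} (G : SimpleGraph V) : ℕ :=
  G.maximalDissociationSets.ncard

/-- The disjoint union `k G` of `k` copies of `G`. The vertex `(i, v)` is the vertex `v` of the
`i`-th copy. For `k = 0` it is the graph without vertices. -/
def disjointCopies {V : Type*} (k : ℕ) (G : SimpleGraph V) : SimpleGraph (Fin k × V) where
  Adj p q := p.1 = q.1 ∧ G.Adj p.2 q.2
  symm := ⟨fun _ _ h => ⟨h.1.symm, h.2.symm⟩⟩
  loopless := ⟨fun _ h => h.2.ne rfl⟩

end SimpleGraph

/-! Put q = 6^(-1/4) and give G[S] the weight φ(G[S]) q^|S|; the theorem says that the weight is at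
most 1, with equality exactly for disjoint unions of C₄. Fixing the trace of a maximal dissociation
set on a deleted part R bounds the number of completions by φ(G[S \ R]) whenever the chosen vertices
have no neighbour outside R. Branching on a vertex v (absent, isolated, or matched to a neighbour u)
therefore bounds the weight by smaller weights, each multiplied by q to the number of deleted
vertices. Triangle-freeness makes the matched branch delete exactly d(v) + d(u) vertices.

Plain induction on "weight ≤ 1" is too weak, so `WeightBound` also asserts weight ≤ 0.79 when some
vertex has degree at most 1; a branch that creates such a vertex then gains a constant factor.
`weight_lt_or_exists_isFourCycleIn` splits by degrees: degree at most 1, degree at least 3 next to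
degree 2, degree at least 4, cubic, 2-regular. Every case gives weight below 1 unless a component is
C₄. That component has weight 6 q^4 = 1, and since weight is multiplicative it can be removed
without changing the weight. Peeling off such components gives both the bound and the equality case.
-/

namespace SimpleGraph

/-! ### Branching inequalities for the number of maximal dissociation sets -/

section Counting

open Finset
open scoped Classical

variable {V : Type*} (G : SimpleGraph V)

/-- The neighbours of `v` that lie in the finite set `S`. -/
noncomputable def nbrsIn (S : Finset V) (v : V) : Finset V := S.filter (G.Adj v)

/-- The degree of `v` into the finite set `S`. -/
noncomputable def degIn (S : Finset V) (v : V) : ℕ := #(G.nbrsIn S v)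

/-- The closed neighbourhood of `v` in `S`. -/
noncomputable def closedNbrsIn (S : Finset V) (v : V) : Finset V := insert v (G.nbrsIn S v)

/-- Dissociation sets, for finsets. -/
def Dissoc (F : Finset V) : Prop := ∀ v ∈ F, G.degIn F v ≤ 1

/-- The maximal dissociation sets of the subgraph induced by `S`. -/
noncomputable def mdsIn (S : Finset V) : Finset (Finset V) :=
  S.powerset.filter fun F => G.Dissoc F ∧ ∀ y ∈ S, y ∉ F → ¬ G.Dissoc (insert y F)

/-- The maximal dissociation sets of `S` with prescribed trace `A` on `R`. -/
noncomputable def fiber (S R A : Finset V) : Finset (Finset V) :=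
  (G.mdsIn S).filter fun F => F ∩ R = A

variable {G}

@[simp] lemma mem_nbrsIn {S : Finset V} {v x : V} : x ∈ G.nbrsIn S v ↔ x ∈ S ∧ G.Adj v x := by
  simp [nbrsIn]

@[simp] lemma mem_closedNbrsIn {S : Finset V} {v x : V} :
    x ∈ G.closedNbrsIn S v ↔ x = v ∨ x ∈ S ∧ G.Adj v x := by
  simp [closedNbrsIn]

lemma mem_mdsIn {S F : Finset V} :
    F ∈ G.mdsIn S ↔ F ⊆ S ∧ G.Dissoc F ∧ ∀ y ∈ S, y ∉ F → ¬ G.Dissoc (insert y F) := by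
  simp [mdsIn]

lemma mem_fiber {S R A F : Finset V} : F ∈ G.fiber S R A ↔ F ∈ G.mdsIn S ∧ F ∩ R = A := by
  simp [fiber]

lemma nbrsIn_mono {S T : Finset V} (h : S ⊆ T) (v : V) : G.nbrsIn S v ⊆ G.nbrsIn T v :=
  filter_subset_filter _ h

lemma degIn_mono {S T : Finset V} (h : S ⊆ T) (v : V) : G.degIn S v ≤ G.degIn T v :=
  card_le_card (nbrsIn_mono h v)

lemma closedNbrsIn_subset {S : Finset V} {v : V} (hv : v ∈ S) : G.closedNbrsIn S v ⊆ S := by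
  intro x hx
  rcases mem_closedNbrsIn.1 hx with rfl | h
  exacts [hv, h.1]

lemma card_closedNbrsIn (S : Finset V) (v : V) : #(G.closedNbrsIn S v) = G.degIn S v + 1 := by
  rw [closedNbrsIn, card_insert_of_notMem (by simp)]; rfl

lemma Dissoc.mono {F F' : Finset V} (h : G.Dissoc F) (hF : F' ⊆ F) : G.Dissoc F' :=
  fun v hv => (degIn_mono hF v).trans (h v (hF hv))

lemma Dissoc.union {A B : Finset V} (hA : G.Dissoc A) (hB : G.Dissoc B)
    (h : ∀ a ∈ A, ∀ b ∈ B, ¬ G.Adj a b) : G.Dissoc (A ∪ B) := by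
  intro v hv
  rcases mem_union.1 hv with hv | hv
  · refine le_trans (card_le_card fun x hx => ?_) (hA v hv)
    simp only [mem_nbrsIn, mem_union] at hx ⊢
    exact ⟨hx.1.resolve_right fun hb => h v hv x hb hx.2, hx.2⟩
  · refine le_trans (card_le_card fun x hx => ?_) (hB v hv)
    simp only [mem_nbrsIn, mem_union] at hx ⊢
    exact ⟨hx.1.resolve_left fun ha => h x ha v hv hx.2.symm, hx.2⟩

/-- With no edges from F ∩ R to S \ R, a vertex that could be added to F \ R could be added to F as
well. -/
lemma sdiff_mem_mdsIn {S R F : Finset V} (hF : F ∈ G.mdsIn S)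
    (h : ∀ a ∈ F ∩ R, ∀ y ∈ S \ R, ¬ G.Adj a y) : F \ R ∈ G.mdsIn (S \ R) := by
  obtain ⟨hFS, hd, hmax⟩ := mem_mdsIn.1 hF
  refine mem_mdsIn.2 ⟨sdiff_subset_sdiff hFS le_rfl, hd.mono sdiff_subset, fun y hy hyF hdy => ?_⟩
  obtain ⟨hyS, hyR⟩ := mem_sdiff.1 hy
  refine hmax y hyS (fun hy' => hyF (mem_sdiff.2 ⟨hy', hyR⟩)) ?_
  have : insert y F = (F ∩ R) ∪ insert y (F \ R) := by
    ext x; simp only [mem_insert, mem_union, mem_inter, mem_sdiff]; tauto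
  rw [this]
  refine (hd.mono inter_subset_left).union hdy fun a ha b hb => h a ha b ?_
  rcases mem_insert.1 hb with rfl | hb
  exacts [hy, sdiff_subset_sdiff hFS le_rfl hb]

/-- Deleting R is injective on the fiber, because the deleted trace is always A. -/
lemma card_fiber_le {S R A : Finset V} (h : ∀ a ∈ A, ∀ y ∈ S \ R, ¬ G.Adj a y) :
    #(G.fiber S R A) ≤ #(G.mdsIn (S \ R)) := by
  refine card_le_card_of_injOn (· \ R) (fun F hF => ?_) fun F hF F' hF' hFF' => ?_
  · obtain ⟨h1, rfl⟩ := mem_fiber.1 hF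
    exact sdiff_mem_mdsIn h1 h
  · have h1 := (mem_fiber.1 hF).2
    have h2 := (mem_fiber.1 hF').2
    rw [← sdiff_union_inter F R, ← sdiff_union_inter F' R, h1, h2]
    simpa using congrArg (· ∪ A) hFF'

/-- In a maximal dissociation set, a vertex is isolated or has exactly one partner. -/
lemma mem_fiber_of_mem {S F : Finset V} {v : V} (hF : F ∈ G.mdsIn S) (hv : v ∈ F) :
    F ∈ G.fiber S (G.closedNbrsIn S v) {v} ∨ ∃ u ∈ G.nbrsIn S v,
      F ∈ G.fiber S (G.closedNbrsIn S v ∪ G.closedNbrsIn S u) {v, u} := by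
  obtain ⟨hFS, hd, -⟩ := mem_mdsIn.1 hF
  by_cases h0 : G.nbrsIn F v = ∅
  · left
    refine mem_fiber.2 ⟨hF, ?_⟩
    ext x
    simp only [mem_inter, mem_closedNbrsIn, mem_singleton]
    constructor
    · rintro ⟨hx, rfl | h⟩
      · rfl
      · exact absurd (mem_nbrsIn.2 ⟨hx, h.2⟩) (by simp [h0])
    · rintro rfl
      exact ⟨hv, .inl rfl⟩
  · right
    obtain ⟨u, hu⟩ := nonempty_iff_ne_empty.2 h0
    obtain ⟨huF, huv⟩ := mem_nbrsIn.1 hu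
    refine ⟨u, mem_nbrsIn.2 ⟨hFS huF, huv⟩, mem_fiber.2 ⟨hF, ?_⟩⟩
    have e1 := card_le_one.1 (hd v hv)
    have e2 := card_le_one.1 (hd u huF)
    ext x
    simp only [mem_inter, mem_union, mem_closedNbrsIn, mem_singleton, mem_insert]
    constructor
    · rintro ⟨hx, (rfl | h) | (rfl | h)⟩
      · exact .inl rfl
      · exact .inr (e1 x (mem_nbrsIn.2 ⟨hx, h.2⟩) u hu)
      · exact .inr rfl
      · exact .inl (e2 x (mem_nbrsIn.2 ⟨hx, h.2⟩) v (mem_nbrsIn.2 ⟨hv, huv.symm⟩))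
    · rintro (rfl | rfl)
      · exact ⟨hv, .inl (.inl rfl)⟩
      · exact ⟨huF, .inr (.inl rfl)⟩

lemma card_fiber_pair_le (S : Finset V) (v u : V) :
    #(G.fiber S (G.closedNbrsIn S v ∪ G.closedNbrsIn S u) {v, u}) ≤
      #(G.mdsIn (S \ (G.closedNbrsIn S v ∪ G.closedNbrsIn S u))) := by
  refine card_fiber_le fun a ha y hy hay => ?_
  simp only [mem_insert, mem_singleton] at ha
  simp only [mem_sdiff, mem_union, mem_closedNbrsIn, not_or, not_and] at hy
  rcases ha with rfl | rfl
  exacts [hy.2.1.2 hy.1 hay, hy.2.2.2 hy.1 hay]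

/-- Branching on a vertex `v`: it is absent, isolated, or has a partner. -/
lemma card_mdsIn_le_branch (S : Finset V) (v : V) :
    #(G.mdsIn S) ≤ #(G.mdsIn (S \ {v})) + #(G.mdsIn (S \ G.closedNbrsIn S v)) +
      ∑ u ∈ G.nbrsIn S v, #(G.mdsIn (S \ (G.closedNbrsIn S v ∪ G.closedNbrsIn S u))) := by
  have hsub : G.mdsIn S ⊆ G.fiber S {v} ∅ ∪ G.fiber S (G.closedNbrsIn S v) {v} ∪
      (G.nbrsIn S v).biUnion
        fun u => G.fiber S (G.closedNbrsIn S v ∪ G.closedNbrsIn S u) {v, u} := by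
    intro F hF
    simp only [mem_union, mem_biUnion]
    by_cases hv : v ∈ F
    · rcases mem_fiber_of_mem hF hv with h | h
      exacts [.inl (.inr h), .inr h]
    · exact .inl (.inl (mem_fiber.2 ⟨hF, inter_singleton_of_notMem hv⟩))
  refine (card_le_card hsub).trans ((card_union_le _ _).trans (add_le_add
    ((card_union_le _ _).trans (add_le_add (card_fiber_le (by simp)) (card_fiber_le ?_)))
    (card_biUnion_le.trans (sum_le_sum fun u _ => card_fiber_pair_le S v u))))
  intro a ha y hy hay
  simp only [mem_singleton] at ha
  subst ha
  simp only [mem_sdiff, mem_closedNbrsIn, not_or, not_and] at hy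
  exact hy.2.2 hy.1 hay

/-- By maximality it suffices that adding x is harmless: either x becomes isolated, or it forms an
isolated edge with its only neighbour. The hypothesis is vacuous when x has no neighbour in F. -/
lemma mem_of_pendant {S F : Finset V} {x : V} (hF : F ∈ G.mdsIn S) (hx : x ∈ S)
    (h : ∀ y ∈ F, G.Adj x y → G.nbrsIn F y = ∅ ∧ G.degIn S x ≤ 1) : x ∈ F := by
  obtain ⟨hFS, hd, hmax⟩ := mem_mdsIn.1 hF
  by_contra hxF
  refine hmax x hx hxF fun z hz => ?_
  rcases mem_insert.1 hz with rfl | hz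
  · by_cases h0 : G.nbrsIn F z = ∅
    · have : G.nbrsIn (insert z F) z = ∅ := by
        ext y
        have := congrArg (y ∈ ·) h0
        simp at this
        simp only [mem_nbrsIn, mem_insert, notMem_empty, iff_false, not_and]
        rintro (rfl | hy)
        exacts [G.loopless.irrefl _, this hy]
      simp [degIn, this]
    · obtain ⟨y, hy⟩ := nonempty_iff_ne_empty.2 h0
      obtain ⟨hyF, hxy⟩ := mem_nbrsIn.1 hy
      exact (degIn_mono (insert_subset hx hFS) z).trans (h y hyF hxy).2
  · by_cases hxz : G.Adj x z
    · have h0 := (h z hz hxz).1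
      refine le_trans (card_le_card (t := {x}) fun y hy => ?_) (by simp)
      obtain ⟨hy, hzy⟩ := mem_nbrsIn.1 hy
      rcases mem_insert.1 hy with rfl | hy
      · simp
      · exact absurd (mem_nbrsIn.2 ⟨hy, hzy⟩) (by simp [h0])
    · refine le_trans (card_le_card fun y hy => ?_) (hd z hz)
      obtain ⟨hy, hzy⟩ := mem_nbrsIn.1 hy
      rcases mem_insert.1 hy with rfl | hy
      · exact absurd hzy.symm hxz
      · exact mem_nbrsIn.2 ⟨hy, hzy⟩

/-- Branching on a vertex `w` that has a nonempty set `L` of pendant neighbours. -/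
lemma card_mdsIn_le_leafBranch {S L : Finset V} {w : V} (hLne : L.Nonempty)
    (hL : ∀ x ∈ L, G.nbrsIn S x = {w}) (hLS : L ⊆ S) :
    #(G.mdsIn S) ≤ #(G.mdsIn (S \ insert w L)) +
      ∑ u ∈ G.nbrsIn S w, #(G.mdsIn (S \ (G.closedNbrsIn S w ∪ G.closedNbrsIn S u))) := by
  have hadj : ∀ x ∈ L, ∀ y ∈ S, G.Adj x y → y = w := fun x hx y hy hxy => by
    have : y ∈ G.nbrsIn S x := mem_nbrsIn.2 ⟨hy, hxy⟩
    simpa [hL x hx] using this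
  have hadj' : ∀ x ∈ L, G.Adj x w := fun x hx => by
    have : w ∈ G.nbrsIn S x := by simp [hL x hx]
    exact (mem_nbrsIn.1 this).2
  have hdeg : ∀ x ∈ L, G.degIn S x ≤ 1 := fun x hx => by simp [degIn, hL x hx]
  have hsub : G.mdsIn S ⊆ G.fiber S (insert w L) L ∪
      (G.nbrsIn S w).biUnion
        fun u => G.fiber S (G.closedNbrsIn S w ∪ G.closedNbrsIn S u) {w, u} := by
    intro F hF
    have hFS := (mem_mdsIn.1 hF).1
    simp only [mem_union, mem_biUnion]
    by_cases hw : w ∈ F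
    · rcases mem_fiber_of_mem hF hw with h | h
      -- The vertex w cannot be isolated in F: a pendant neighbour of w would then belong to F by
      -- maximality.
      · exfalso
        have h2 := (mem_fiber.1 h).2
        have hemp : G.nbrsIn F w = ∅ := by
          ext y
          simp only [mem_nbrsIn, notMem_empty, iff_false, not_and]
          intro hy hwy
          have : y ∈ F ∩ G.closedNbrsIn S w :=
            mem_inter.2 ⟨hy, mem_closedNbrsIn.2 (.inr ⟨hFS hy, hwy⟩)⟩
          rw [h2, mem_singleton] at this
          exact G.loopless.irrefl _ (this ▸ hwy)
        obtain ⟨x, hx⟩ := hLne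
        have : x ∈ F := mem_of_pendant hF (hLS hx) fun y hy hxy => by
          rw [hadj x hx y (hFS hy) hxy]
          exact ⟨hemp, hdeg x hx⟩
        have : x ∈ G.nbrsIn F w := mem_nbrsIn.2 ⟨this, (hadj' x hx).symm⟩
        simp [hemp] at this
      · exact .inr h
    -- Without w nothing blocks the pendant vertices, so all of L lies in F. The absent and isolated
    -- branches thus merge into one that deletes all of {w} ∪ L.
    · refine .inl (mem_fiber.2 ⟨hF, ?_⟩)
      ext x
      simp only [mem_inter, mem_insert]
      constructor
      · rintro ⟨hx, rfl | h⟩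
        exacts [absurd hx hw, h]
      · intro hx
        refine ⟨mem_of_pendant hF (hLS hx) fun y hy hxy => ?_, .inr hx⟩
        exact absurd (hadj x hx y (hFS hy) hxy ▸ hy) hw
  refine (card_le_card hsub).trans ((card_union_le _ _).trans (add_le_add
    (card_fiber_le ?_)
    (card_biUnion_le.trans (sum_le_sum fun u _ => card_fiber_pair_le S w u))))
  intro a ha y hy hay
  simp only [mem_sdiff, mem_insert, not_or] at hy
  exact hy.2.1 (hadj a ha y hy.1 hay)

/-- A component on which every vertex belongs to each maximal dissociation set. -/
lemma card_mdsIn_le_of_forced {S R : Finset V} (hRS : R ⊆ S)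
    (hR : ∀ x ∈ R, ∀ y ∈ S, G.Adj x y → y ∈ R) (hd : G.Dissoc R) :
    #(G.mdsIn S) ≤ #(G.mdsIn (S \ R)) := by
  refine le_trans (card_le_card (t := G.fiber S R R) fun F hF => mem_fiber.2 ⟨hF, ?_⟩)
    (card_fiber_le fun a ha y hy hay => (mem_sdiff.1 hy).2 (hR a ha y (mem_sdiff.1 hy).1 hay))
  obtain ⟨hFS, hdF, hmax⟩ := mem_mdsIn.1 hF
  refine inter_eq_right.2 fun x hx => ?_
  by_contra hxF
  refine hmax x (hRS hx) hxF (Dissoc.mono (F := R ∪ F \ R) ?_ ?_)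
  · refine hd.union (hdF.mono sdiff_subset) fun a ha b hb hab => ?_
    exact (mem_sdiff.1 hb).2 (hR a ha b (hFS (mem_sdiff.1 hb).1) hab)
  · intro y hy
    simp only [mem_insert, mem_union, mem_sdiff] at hy ⊢
    rcases hy with rfl | hy
    · exact .inl hx
    · tauto

/-- The number of maximal dissociation sets is multiplicative over components. -/
lemma card_mdsIn_mul {S R : Finset V} (hRS : R ⊆ S)
    (hR : ∀ x ∈ R, ∀ y ∈ S \ R, ¬ G.Adj x y) :
    #(G.mdsIn S) = #(G.mdsIn R) * #(G.mdsIn (S \ R)) := by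
  rw [← card_product]
  have hsep : ∀ F ⊆ S, ∀ a ∈ F ∩ R, ∀ b ∈ F \ R, ¬ G.Adj a b := fun F hF a ha b hb =>
    hR a (mem_inter.1 ha).2 b (sdiff_subset_sdiff hF le_rfl hb)
  refine card_nbij' (fun F => (F ∩ R, F \ R)) (fun p => p.1 ∪ p.2) ?_ ?_ ?_ ?_
  · intro F hF
    have hFS := (mem_mdsIn.1 hF).1
    refine mem_product.2 ⟨?_, sdiff_mem_mdsIn hF fun a ha y hy => hR a (mem_inter.1 ha).2 y hy⟩
    have := sdiff_mem_mdsIn (R := S \ R) hF fun a ha y hy hay =>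
      hR y (by simpa using fun h => (mem_sdiff.1 hy).2 (mem_sdiff.2 ⟨(mem_sdiff.1 hy).1, h⟩)) a
        (mem_inter.1 ha).2 hay.symm
    have e1 : S \ (S \ R) = R := by simpa using hRS
    have e2 : F \ (S \ R) = F ∩ R := by
      ext x; have := @hFS x; simp only [mem_sdiff, mem_inter]; tauto
    rwa [e1, e2] at this
  · rintro ⟨A, B⟩ h
    obtain ⟨hA, hB⟩ := mem_product.1 h
    obtain ⟨hAR, hdA, hmA⟩ := mem_mdsIn.1 hA
    obtain ⟨hBR, hdB, hmB⟩ := mem_mdsIn.1 hB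
    refine mem_mdsIn.2 ⟨union_subset (hAR.trans hRS) (hBR.trans sdiff_subset),
      hdA.union hdB fun a ha b hb => hR a (hAR ha) b (hBR hb), fun y hy hyn hd => ?_⟩
    simp only [mem_union, not_or] at hyn
    by_cases hyR : y ∈ R
    · exact hmA y hyR hyn.1 (hd.mono (insert_subset_insert _ subset_union_left))
    · exact hmB y (mem_sdiff.2 ⟨hy, hyR⟩) hyn.2
        (hd.mono (insert_subset_insert _ subset_union_right))
  · intro F _
    exact (union_comm _ _).trans (sdiff_union_inter F R)
  · rintro ⟨A, B⟩ h
    obtain ⟨hA, hB⟩ := mem_product.1 h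
    have hAR := (mem_mdsIn.1 hA).1
    have hBR := (mem_mdsIn.1 hB).1
    simp only [Prod.mk.injEq]
    constructor <;> ext x <;> have h1 := @hAR x <;> have h2 := @hBR x <;>
      simp only [mem_inter, mem_union, mem_sdiff] at h2 ⊢ <;> tauto

end Counting

/-! ### Normalised weights -/

section Weighted

open Finset
open scoped Classical

/-- The number `6 ^ (-1/4)`. -/
noncomputable def invRate : ℝ := (6 : ℝ) ^ (-(1 / 4) : ℝ)

local notation "q" => invRate

lemma invRate_pos : 0 < q := Real.rpow_pos_of_pos (by norm_num) _

lemma invRate_pow_four : q ^ 4 = 1 / 6 := by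
  rw [invRate, ← Real.rpow_natCast, ← Real.rpow_mul (by norm_num)]
  norm_num [Real.rpow_neg_one]

lemma invRate_lt : q < 0.639 := by
  refine lt_of_pow_lt_pow_left₀ 4 (by norm_num) ?_
  rw [invRate_pow_four]; norm_num

lemma invRate_sq_lt : q ^ 2 < 0.4083 := by
  refine lt_of_pow_lt_pow_left₀ 2 (by norm_num) ?_
  rw [← pow_mul, invRate_pow_four]; norm_num

lemma invRate_pow_three_lt : q ^ 3 < 0.2609 := by
  refine lt_of_pow_lt_pow_left₀ 4 (by norm_num) ?_
  rw [← pow_mul, mul_comm, pow_mul, invRate_pow_four]; norm_num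

lemma invRate_pow_add_four (k : ℕ) : q ^ (k + 4) = q ^ k / 6 := by
  rw [pow_add, invRate_pow_four]; ring

lemma invRate_pow_anti {i j : ℕ} (h : i ≤ j) : q ^ j ≤ q ^ i :=
  pow_le_pow_of_le_one invRate_pos.le (invRate_lt.le.trans (by norm_num)) h

/-- The ratio of consecutive terms is (1 + 1/d) q ≤ 1.5 · 0.639 < 1. This reduces estimates for
arbitrary degree to the smallest one. -/
lemma mul_invRate_pow_anti {k d : ℕ} (hk : 2 ≤ k) (h : k ≤ d) :
    (d : ℝ) * q ^ d ≤ k * q ^ k := by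
  induction d, h using Nat.le_induction with
  | base => rfl
  | succ d hd ih =>
    refine le_trans ?_ ih
    have h2 : (2 : ℝ) ≤ d := by exact_mod_cast hk.trans hd
    have := pow_pos invRate_pos d
    have := invRate_lt
    rw [pow_succ, mul_comm (q ^ d), ← mul_assoc]
    refine mul_le_mul_of_nonneg_right ?_ (by positivity)
    push_cast
    nlinarith

variable {V : Type*} (G : SimpleGraph V)

/-- The number of maximal dissociation sets of `G[S]`, divided by `6 ^ (|S| / 4)`. -/
noncomputable def weight (S : Finset V) : ℝ := #(G.mdsIn S) * q ^ #S

variable {G}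

lemma card_mul_eq_weight {S R : Finset V} (hR : R ⊆ S) :
    (#(G.mdsIn (S \ R)) : ℝ) * q ^ #S = q ^ #R * G.weight (S \ R) := by
  rw [weight, ← card_sdiff_add_card_eq_card hR, pow_add]; ring

lemma CliqueFree.not_adj_of_adj (hG : G.CliqueFree 3) {a b c : V} (hab : G.Adj a b)
    (hac : G.Adj a c) : ¬ G.Adj b c :=
  fun hbc => hG {a, b, c} (is3Clique_triple_iff.2 ⟨hab, hac, hbc⟩)

/-- Each of v, u lies in the neighbourhood of the other, so the union is that of the open
neighbourhoods; these are disjoint for lack of triangles. -/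
lemma card_closedNbrsIn_union (hG : G.CliqueFree 3) {S : Finset V} {v u : V} (hv : v ∈ S)
    (hu : u ∈ G.nbrsIn S v) :
    #(G.closedNbrsIn S v ∪ G.closedNbrsIn S u) = G.degIn S v + G.degIn S u := by
  obtain ⟨huS, huv⟩ := mem_nbrsIn.1 hu
  have : G.closedNbrsIn S v ∪ G.closedNbrsIn S u = G.nbrsIn S v ∪ G.nbrsIn S u := by
    ext x
    simp only [mem_union, mem_closedNbrsIn, mem_nbrsIn]
    constructor
    · rintro ((rfl | h) | (rfl | h))
      exacts [.inr ⟨hv, huv.symm⟩, .inl h, .inl ⟨huS, huv⟩, .inr h]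
    · tauto
  rw [this, card_union_of_disjoint, degIn, degIn]
  rw [Finset.disjoint_left]
  intro x hx hx'
  simp only [mem_nbrsIn] at hx hx'
  exact hG.not_adj_of_adj huv hx.2 hx'.2

lemma weight_pair (hG : G.CliqueFree 3) {S : Finset V} {v u : V} (hv : v ∈ S)
    (hu : u ∈ G.nbrsIn S v) :
    (#(G.mdsIn (S \ (G.closedNbrsIn S v ∪ G.closedNbrsIn S u))) : ℝ) * q ^ #S =
      q ^ (G.degIn S v + G.degIn S u) *
        G.weight (S \ (G.closedNbrsIn S v ∪ G.closedNbrsIn S u)) := by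
  rw [card_mul_eq_weight (union_subset (closedNbrsIn_subset hv)
    (closedNbrsIn_subset (mem_nbrsIn.1 hu).1)), card_closedNbrsIn_union hG hv hu]

lemma weight_le_branch (hG : G.CliqueFree 3) {S : Finset V} {v : V} (hv : v ∈ S) :
    G.weight S ≤ q * G.weight (S \ {v}) +
      q ^ (G.degIn S v + 1) * G.weight (S \ G.closedNbrsIn S v) +
      ∑ u ∈ G.nbrsIn S v, q ^ (G.degIn S v + G.degIn S u) *
        G.weight (S \ (G.closedNbrsIn S v ∪ G.closedNbrsIn S u)) := by
  rw [← sum_congr rfl fun u hu => weight_pair hG hv hu, ← card_closedNbrsIn,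
    ← card_mul_eq_weight (closedNbrsIn_subset hv)]
  have := card_mul_eq_weight (G := G) (S := S) (R := {v}) (by simpa using hv)
  rw [card_singleton, pow_one] at this
  rw [← this, ← sum_mul, ← add_mul, ← add_mul, weight]
  refine mul_le_mul_of_nonneg_right ?_ (pow_nonneg invRate_pos.le _)
  exact_mod_cast card_mdsIn_le_branch S v

lemma weight_le_leafBranch (hG : G.CliqueFree 3) {S L : Finset V} {w : V} (hw : w ∈ S)
    (hLne : L.Nonempty) (hL : ∀ x ∈ L, G.nbrsIn S x = {w}) (hLS : L ⊆ S) :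
    G.weight S ≤ q ^ (#L + 1) * G.weight (S \ insert w L) +
      ∑ u ∈ G.nbrsIn S w, q ^ (G.degIn S w + G.degIn S u) *
        G.weight (S \ (G.closedNbrsIn S w ∪ G.closedNbrsIn S u)) := by
  have hwL : w ∉ L := fun h => by
    have : w ∈ G.nbrsIn S w := by simp [hL w h]
    exact G.loopless.irrefl _ (mem_nbrsIn.1 this).2
  rw [← sum_congr rfl fun u hu => weight_pair hG hw hu, ← card_insert_of_notMem hwL,
    ← card_mul_eq_weight (insert_subset hw hLS)]
  rw [← sum_mul, ← add_mul, weight]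
  refine mul_le_mul_of_nonneg_right ?_ (pow_nonneg invRate_pos.le _)
  exact_mod_cast card_mdsIn_le_leafBranch hLne hL hLS

lemma weight_le_of_forced {S R : Finset V} (hRS : R ⊆ S)
    (hR : ∀ x ∈ R, ∀ y ∈ S, G.Adj x y → y ∈ R) (hd : G.Dissoc R) :
    G.weight S ≤ q ^ #R * G.weight (S \ R) := by
  rw [← card_mul_eq_weight hRS, weight]
  refine mul_le_mul_of_nonneg_right ?_ (pow_nonneg invRate_pos.le _)
  exact_mod_cast card_mdsIn_le_of_forced hRS hR hd

lemma weight_mul {S R : Finset V} (hRS : R ⊆ S) (hR : ∀ x ∈ R, ∀ y ∈ S \ R, ¬ G.Adj x y) :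
    G.weight S = G.weight R * G.weight (S \ R) := by
  rw [weight, weight, weight, card_mdsIn_mul hRS hR, ← card_sdiff_add_card_eq_card hRS, pow_add]
  push_cast; ring

end Weighted

/-! ### The induction: vertices of degree at most 1 -/

section Extremal

open Finset
open scoped Classical

local notation "q" => invRate

variable {V : Type*} {G : SimpleGraph V}

/-- The bound to be proved by induction on `S`: the weight is at most `1`, and it is smaller
by a constant factor if there is a vertex of degree at most `1`. -/
def WeightBound (G : SimpleGraph V) (S : Finset V) : Prop :=
  G.weight S ≤ 1 ∧ ((∃ u ∈ S, G.degIn S u ≤ 1) → G.weight S ≤ 0.79)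

lemma sdiff_ssubset_of_mem {S R : Finset V} {v : V} (hv : v ∈ S) (hvR : v ∈ R) : S \ R ⊂ S :=
  (ssubset_iff_of_subset sdiff_subset).2 ⟨v, hv, fun h => (mem_sdiff.1 h).2 hvR⟩

lemma degIn_sdiff_add_one_le {S R : Finset V} {x w : V} (hw : w ∈ G.nbrsIn S x) (hwR : w ∈ R) :
    G.degIn (S \ R) x + 1 ≤ G.degIn S x := by
  rw [degIn, ← card_insert_of_notMem (a := w) (by simp [hwR])]
  exact card_le_card (insert_subset hw (nbrsIn_mono sdiff_subset x))

lemma degIn_le_degIn_sdiff_singleton (S : Finset V) (x v : V) :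
    G.degIn S x ≤ G.degIn (S \ {v}) x + 1 := by
  refine le_trans (card_le_card (t := insert v (G.nbrsIn (S \ {v}) x)) fun y hy => ?_)
    (card_insert_le _ _)
  simp only [mem_nbrsIn, mem_insert, mem_sdiff, mem_singleton] at hy ⊢
  tauto

lemma nbrsIn_sdiff_singleton {S : Finset V} {x v : V} (h : ¬ G.Adj x v) :
    G.nbrsIn (S \ {v}) x = G.nbrsIn S x := by
  ext y
  simp only [mem_nbrsIn, mem_sdiff, mem_singleton]
  exact ⟨fun h => ⟨h.1.1, h.2⟩, fun h' => ⟨⟨h'.1, fun e => h (e ▸ h'.2)⟩, h'.2⟩⟩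

lemma mul_weight_le {S R : Finset V} {v : V} (ih : ∀ T ⊂ S, G.WeightBound T) (hv : v ∈ S)
    (hvR : v ∈ R) {i j : ℕ} (hij : i ≤ j) : q ^ j * G.weight (S \ R) ≤ q ^ i :=
  (mul_le_of_le_one_right (pow_nonneg invRate_pos.le _)
    (ih _ (sdiff_ssubset_of_mem hv hvR)).1).trans (invRate_pow_anti hij)

lemma sum_pair_le {S : Finset V} {v : V} (ih : ∀ T ⊂ S, G.WeightBound T) (hv : v ∈ S) {k : ℕ}
    (A : Finset V) (h : ∀ u ∈ A, k ≤ G.degIn S u) :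
    ∑ u ∈ A, q ^ (G.degIn S v + G.degIn S u) *
        G.weight (S \ (G.closedNbrsIn S v ∪ G.closedNbrsIn S u)) ≤
      #A * q ^ (G.degIn S v + k) := by
  rw [← nsmul_eq_mul]
  refine sum_le_card_nsmul _ _ _ fun u hu => ?_
  refine mul_weight_le ih hv (by simp) ?_
  have := h u hu
  omega

/-- The bound for a vertex `w` of degree at least `2` with exactly the pendant neighbours `L`. -/
lemma weight_le_of_pendant_set (hG : G.CliqueFree 3) {S L : Finset V} {w : V}
    (ih : ∀ T ⊂ S, G.WeightBound T) (hw : w ∈ S) (hLne : L.Nonempty)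
    (hL : ∀ x, x ∈ L ↔ x ∈ S ∧ G.nbrsIn S x = {w}) :
    ∃ R, w ∈ R ∧ (∀ z, z ∈ R ↔ z = w ∨ z ∈ L) ∧
    G.weight S ≤ q ^ (#L + 1) * G.weight (S \ R) + #L * q ^ (G.degIn S w + 1) +
      ∑ u ∈ G.nbrsIn S w \ L, q ^ (G.degIn S w + G.degIn S u) *
        G.weight (S \ (G.closedNbrsIn S w ∪ G.closedNbrsIn S u)) := by
  refine ⟨insert w L, by simp, by simp, ?_⟩
  have hLN : L ⊆ G.nbrsIn S w := fun x hx => by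
    obtain ⟨hxS, hx⟩ := (hL x).1 hx
    have : w ∈ G.nbrsIn S x := by simp [hx]
    exact mem_nbrsIn.2 ⟨hxS, (mem_nbrsIn.1 this).2.symm⟩
  refine (weight_le_leafBranch hG hw hLne (fun x hx => ((hL x).1 hx).2)
    fun x hx => ((hL x).1 hx).1).trans ?_
  rw [← sum_sdiff hLN, add_comm (∑ u ∈ _ \ _, _), ← add_assoc]
  gcongr
  refine sum_pair_le ih hw L fun u hu => ?_
  simp [degIn, ((hL u).1 hu).2]

/-- An isolated vertex or an isolated edge gives a factor q or q^2. Otherwise branch on the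
neighbour w of u, of degree k ≥ 2, with all its pendant neighbours L. The constant 0.79 is dictated
by |L| = 1, k = 3, where the bound is q^2 + q^4 + 2q^5 ≈ 0.788. -/
lemma weight_le_of_degIn_le_one (hG : G.CliqueFree 3) {S : Finset V}
    (ih : ∀ T ⊂ S, G.WeightBound T) {u : V} (hu : u ∈ S) (hdu : G.degIn S u ≤ 1) :
    G.weight S ≤ 0.79 := by
  have q0 := invRate_pos
  have q1 := invRate_lt
  have q2 := invRate_sq_lt
  have q3 := invRate_pow_three_lt
  have q4 := invRate_pow_four
  by_cases h0 : G.nbrsIn S u = ∅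
  · have := weight_le_of_forced (G := G) (S := S) (R := {u}) (by simpa using hu)
      (fun x hx y hy hxy => by
        rw [mem_singleton.1 hx] at hxy
        have : y ∈ G.nbrsIn S u := mem_nbrsIn.2 ⟨hy, hxy⟩
        simp [h0] at this)
      (fun x hx => (card_le_card (filter_subset _ _)).trans (by simp))
    have h2 := mul_weight_le (R := {u}) ih hu (by simp) (le_refl 1)
    simp only [card_singleton] at this
    linarith [pow_one q]
  obtain ⟨w, hw⟩ := nonempty_iff_ne_empty.2 h0
  have hNu : G.nbrsIn S u = {w} :=
    eq_singleton_iff_unique_mem.2 ⟨hw, fun x hx => card_le_one.1 hdu x hx w hw⟩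
  obtain ⟨hwS, huw⟩ := mem_nbrsIn.1 hw
  have huNw : u ∈ G.nbrsIn S w := mem_nbrsIn.2 ⟨hu, huw.symm⟩
  rcases le_or_gt (G.degIn S w) 1 with hdw | hdw
  · have hNw : ∀ x ∈ S, G.Adj w x → x = u := fun x hx hwx =>
      card_le_one.1 hdw x (mem_nbrsIn.2 ⟨hx, hwx⟩) u huNw
    have := weight_le_of_forced (G := G) (S := S) (R := {u, w})
      (insert_subset hu (by simpa using hwS))
      (fun x hx y hy hxy => by
        simp only [mem_insert, mem_singleton] at hx ⊢
        rcases hx with rfl | rfl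
        · exact .inr (by simpa [hNu] using mem_nbrsIn.2 ⟨hy, hxy⟩)
        · exact .inl (hNw y hy hxy))
      (fun x hx => by
        have hsub : ({u, w} : Finset V) ⊆ S := insert_subset hu (by simpa using hwS)
        simp only [mem_insert, mem_singleton] at hx
        rcases hx with rfl | rfl
        exacts [(degIn_mono hsub _).trans hdu, (degIn_mono hsub _).trans hdw])
    have h2 := mul_weight_le (R := {u, w}) ih hu (by simp) (le_refl 2)
    rw [card_pair huw.ne] at this
    linarith
  set L := S.filter fun x => G.nbrsIn S x = {w} with hLdef
  have hL : ∀ x, x ∈ L ↔ x ∈ S ∧ G.nbrsIn S x = {w} := fun x => by simp [hLdef]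
  have huL : u ∈ L := (hL u).2 ⟨hu, hNu⟩
  obtain ⟨R, hwR, hR, hmain⟩ := weight_le_of_pendant_set hG ih hwS ⟨u, huL⟩ hL
  have hLN : L ⊆ G.nbrsIn S w := fun x hx => by
    obtain ⟨hxS, hx⟩ := (hL x).1 hx
    have : w ∈ G.nbrsIn S x := by simp [hx]
    exact mem_nbrsIn.2 ⟨hxS, (mem_nbrsIn.1 this).2.symm⟩
  have hrest : ∀ x ∈ G.nbrsIn S w \ L, 2 ≤ G.degIn S x := fun x hx => by
    obtain ⟨hxw, hxL⟩ := mem_sdiff.1 hx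
    obtain ⟨hxS, hwx⟩ := mem_nbrsIn.1 hxw
    by_contra hlt
    refine hxL ((hL x).2 ⟨hxS, eq_singleton_iff_unique_mem.2 ⟨mem_nbrsIn.2 ⟨hwS, hwx.symm⟩,
      fun y hy => card_le_one.1 (by change G.degIn S x ≤ 1; omega) y hy w
        (mem_nbrsIn.2 ⟨hwS, hwx.symm⟩)⟩⟩)
  have hcard : #(G.nbrsIn S w \ L) + #L = G.degIn S w := card_sdiff_add_card_eq_card hLN
  have hℓ : 1 ≤ #L := card_pos.2 ⟨u, huL⟩
  have hsum := sum_pair_le ih hwS (G.nbrsIn S w \ L) hrest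
  generalize hk : G.degIn S w = k at *
  -- For |L| ≥ 2 the bound is q^3 + k q^(k+1) ≤ 3q^3.
  rcases hℓ.lt_or_eq with hℓ | hℓ
  · have h1 := mul_weight_le (R := R) ih hwS hwR (show 3 ≤ #L + 1 by omega)
    have h2 := mul_invRate_pow_anti le_rfl hdw
    have h3 : (#(G.nbrsIn S w \ L) : ℝ) * q ^ (k + 2) ≤ #(G.nbrsIn S w \ L) * q ^ (k + 1) := by
      gcongr ?_ * ?_
      exact invRate_pow_anti (by omega)
    have h4 : (#(G.nbrsIn S w \ L) : ℝ) * q ^ (k + 1) + #L * q ^ (k + 1) = k * q ^ k * q := by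
      rw [← add_mul, ← hcard]; push_cast; ring
    have h5 : k * q ^ k * q ≤ 2 * q ^ 3 := by
      rw [pow_succ q 2, ← mul_assoc]
      exact mul_le_mul_of_nonneg_right (by exact_mod_cast h2) q0.le
    linarith
  rw [← hℓ] at hmain hcard
  simp only [Nat.cast_one, one_mul, Nat.reduceAdd] at hmain
  rcases Nat.lt_or_ge 2 k with hk3 | hk2
  · have h1 := mul_weight_le (R := R) ih hwS hwR (le_refl 2)
    have h2 := mul_invRate_pow_anti (k := 3) (by norm_num) hk3
    have h3 : (#(G.nbrsIn S w \ L) : ℝ) = k - 1 := by rw [← hcard]; push_cast; ring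
    have h4 : q ^ (k + 1) ≤ q ^ 4 := invRate_pow_anti (by omega)
    -- The regrouping q^(k+1) (1 - q) + k q^k q^2 makes each term decreasing in k, so k = 3 is the
    -- worst case.
    have h5 : (#(G.nbrsIn S w \ L) : ℝ) * q ^ (k + 2) = k * q ^ k * q ^ 2 - q ^ (k + 1) * q := by
      rw [h3]; ring
    have h6 : k * q ^ k * q ^ 2 ≤ 3 * q ^ 4 * q := by
      refine (mul_le_mul_of_nonneg_right h2 (by positivity)).trans (le_of_eq ?_)
      push_cast; ring
    have h7 : q ^ (k + 1) * (1 - q) ≤ q ^ 4 * (1 - q) :=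
      mul_le_mul_of_nonneg_right h4 (by linarith)
    rw [q4] at *
    nlinarith
  · obtain rfl : k = 2 := by omega
    obtain ⟨x, hx⟩ := card_eq_one.1 (show #(G.nbrsIn S w \ L) = 1 by omega)
    rw [hx, sum_singleton] at hmain
    have hxm : x ∈ G.nbrsIn S w \ L := by simp [hx]
    have hxS := (mem_nbrsIn.1 (mem_sdiff.1 hxm).1).1
    have hwx := (mem_nbrsIn.1 (mem_sdiff.1 hxm).1).2
    rcases (hrest x hxm).lt_or_eq with hd | hd
    · have h1 := mul_weight_le (R := R) ih hwS hwR (le_refl 2)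
      have h2 := mul_weight_le (R := G.closedNbrsIn S w ∪ G.closedNbrsIn S x) ih hwS (by simp)
        (show 5 ≤ 2 + G.degIn S x by omega)
      have h3 := invRate_pow_add_four 1
      norm_num at *
      linarith
    -- Deleting w leaves x with degree at most 1, so the first branch gains the factor 0.79.
    · have h1 := (ih _ (sdiff_ssubset_of_mem (R := R) hwS hwR)).2 ⟨x, mem_sdiff.2 ⟨hxS, fun h => by
        rcases (hR x).1 h with rfl | h
        exacts [G.loopless.irrefl _ hwx, (mem_sdiff.1 hxm).2 h]⟩, by
          have := degIn_sdiff_add_one_le (mem_nbrsIn.2 ⟨hwS, hwx.symm⟩) hwR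
          omega⟩
      have h2 := mul_weight_le (R := G.closedNbrsIn S w ∪ G.closedNbrsIn S x) ih hwS (by simp)
        (show 4 ≤ 2 + G.degIn S x by omega)
      norm_num at *
      nlinarith

/-! ### The induction: a vertex of degree at least 3 -/

lemma weight_le_branch_bounds (hG : G.CliqueFree 3) {S : Finset V}
    (ih : ∀ T ⊂ S, G.WeightBound T) {v : V} (hv : v ∈ S) {k : ℕ}
    (h : ∀ u ∈ G.nbrsIn S v, k ≤ G.degIn S u) :
    G.weight S ≤ q * G.weight (S \ {v}) + q ^ (G.degIn S v + 1) +
      G.degIn S v * q ^ (G.degIn S v + k) := by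
  refine (weight_le_branch hG hv).trans ?_
  gcongr
  · exact mul_weight_le ih hv (by simp) le_rfl
  · exact sum_pair_le ih hv _ h

/-- Deleting v leaves u with degree at most 1. The worst degree is 3: 0.79q + q^4 + 3q^5 < 1. -/
lemma weight_lt_of_degIn_two_neighbor (hG : G.CliqueFree 3) {S : Finset V}
    (ih : ∀ T ⊂ S, G.WeightBound T) (hmin : ∀ x ∈ S, 2 ≤ G.degIn S x) {v u : V} (hv : v ∈ S)
    (hdv : 3 ≤ G.degIn S v) (hu : u ∈ G.nbrsIn S v) (hdu : G.degIn S u = 2) :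
    G.weight S < 1 := by
  have q0 := invRate_pos
  have q1 := invRate_lt
  have q4 := invRate_pow_four
  obtain ⟨huS, hvu⟩ := mem_nbrsIn.1 hu
  have h1 := weight_le_branch_bounds hG ih hv fun x hx => hmin x (mem_nbrsIn.1 hx).1
  have h2 := (ih (S \ {v}) (sdiff_ssubset_of_mem hv (by simp))).2 ⟨u, by simp [huS, hvu.ne'], by
    have := degIn_sdiff_add_one_le (mem_nbrsIn.2 ⟨hv, hvu.symm⟩) (mem_singleton_self v)
    omega⟩
  generalize G.degIn S v = d at *
  have h3 := mul_invRate_pow_anti (k := 3) (by norm_num) hdv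
  have h4 : q ^ (d + 1) ≤ q ^ 4 := invRate_pow_anti (by omega)
  have h5 : d * q ^ (d + 2) ≤ 3 * q ^ 4 * q := by
    calc d * q ^ (d + 2) = d * q ^ d * q ^ 2 := by ring
      _ ≤ (3 : ℕ) * q ^ 3 * q ^ 2 := mul_le_mul_of_nonneg_right h3 (by positivity)
      _ = _ := by push_cast; ring
  rw [q4] at *
  nlinarith

/-- The worst degree is 4, with bound q + q^5 + 4q^7 < 1. -/
lemma weight_lt_of_degIn_ge_four (hG : G.CliqueFree 3) {S : Finset V}
    (ih : ∀ T ⊂ S, G.WeightBound T) {v : V} (hv : v ∈ S)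
    (hdv : 4 ≤ G.degIn S v) (hu : ∀ u ∈ G.nbrsIn S v, 3 ≤ G.degIn S u) :
    G.weight S < 1 := by
  have q0 := invRate_pos
  have q1 := invRate_lt
  have q3 := invRate_pow_three_lt
  have q4 := invRate_pow_four
  have h1 := weight_le_branch_bounds hG ih hv hu
  have h2 := (ih (S \ {v}) (sdiff_ssubset_of_mem hv (by simp))).1
  generalize G.degIn S v = d at *
  have h3 := mul_invRate_pow_anti (k := 4) (by norm_num) hdv
  have h4 : q ^ (d + 1) ≤ q ^ 5 := invRate_pow_anti (by omega)
  have h5 : d * q ^ (d + 3) ≤ 4 * q ^ 4 * q ^ 3 := by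
    calc d * q ^ (d + 3) = d * q ^ d * q ^ 3 := by ring
      _ ≤ (4 : ℕ) * q ^ 4 * q ^ 3 := mul_le_mul_of_nonneg_right h3 (by positivity)
      _ = _ := by push_cast; ring
  have h6 := invRate_pow_add_four 1
  norm_num at h6
  rw [q4] at *
  nlinarith

/-- Here v, x, x' form one side of a K₃,₃ component. Deleting v and x leaves a star with centre x'
and three leaves, and leaf branching at x' gives q^4 + 3q^4 = 2/3. -/
lemma weight_sdiff_le_of_complete_second_neighborhood (hG : G.CliqueFree 3) {S : Finset V}
    (ih : ∀ T ⊂ S, G.WeightBound T) {v x x' : V} (hv : v ∈ S)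
    (hdv : G.degIn S v = 3) (hd : ∀ y ∈ G.nbrsIn S v, G.degIn S y = 3)
    (hxS : x ∈ S) (hx'S : x' ∈ S) (hxv : x ≠ v) (hxv' : x' ≠ v) (hxx' : x ≠ x')
    (hx : G.nbrsIn S x = G.nbrsIn S v) (hx' : G.nbrsIn S x' = G.nbrsIn S v) :
    G.weight ((S \ {v}) \ {x}) ≤ 2 / 3 := by
  have hN : ∀ y ∈ G.nbrsIn S v, G.nbrsIn S y = {v, x, x'} := fun y hy => by
    refine (eq_of_subset_of_card_le ?_ ?_).symm
    · have hy1 : y ∈ G.nbrsIn S x := hx ▸ hy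
      have hy2 : y ∈ G.nbrsIn S x' := hx' ▸ hy
      rw [mem_nbrsIn] at hy hy1 hy2
      intro z hz
      simp only [mem_insert, mem_singleton] at hz
      rcases hz with rfl | rfl | rfl
      exacts [mem_nbrsIn.2 ⟨hv, hy.2.symm⟩, mem_nbrsIn.2 ⟨hxS, hy1.2.symm⟩,
        mem_nbrsIn.2 ⟨hx'S, hy2.2.symm⟩]
    · rw [card_eq_three.2 ⟨v, x, x', hxv.symm, hxv'.symm, hxx', rfl⟩]
      exact (hd y hy).le
  set T := (S \ {v}) \ {x} with hT
  have hTS : T ⊂ S := sdiff_subset.trans_ssubset (sdiff_ssubset_of_mem hv (by simp))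
  have hyT : ∀ y ∈ G.nbrsIn S v, y ∈ T := fun y hy => by
    have hy1 : y ∈ G.nbrsIn S x := hx ▸ hy
    rw [mem_nbrsIn] at hy hy1
    simp [hT, hy.1, hy.2.ne', hy1.2.ne']
  have hNT : ∀ y ∈ G.nbrsIn S v, G.nbrsIn T y = {x'} := fun y hy => by
    ext z
    have h1 : z ∈ G.nbrsIn S y ↔ z ∈ ({v, x, x'} : Finset V) := by rw [hN y hy]
    simp only [mem_nbrsIn, mem_insert, mem_singleton, hT, mem_sdiff] at h1 ⊢
    constructor
    · rintro ⟨⟨⟨h2, h3⟩, h4⟩, h5⟩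
      have := h1.1 ⟨h2, h5⟩
      tauto
    · rintro rfl
      have := h1.2 (.inr (.inr rfl))
      tauto
  have hx'T : x' ∈ T := by simp [hT, hx'S, hxv', hxx'.symm]
  have hNx' : G.nbrsIn T x' = G.nbrsIn S v := by
    refine Subset.antisymm ((nbrsIn_mono hTS.subset x').trans hx'.subset) fun y hy => ?_
    have hy2 : y ∈ G.nbrsIn S x' := hx' ▸ hy
    exact mem_nbrsIn.2 ⟨hyT y hy, (mem_nbrsIn.1 hy2).2⟩
  have hne : (G.nbrsIn S v).Nonempty := card_pos.1 (by change 0 < G.degIn S v; omega)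
  have ihT : ∀ U ⊂ T, G.WeightBound U := fun U hU => ih U (hU.trans hTS)
  have h1 := weight_le_leafBranch hG hx'T hne hNT hyT
  have h2 := sum_pair_le ihT hx'T (k := 1) (G.nbrsIn T x') fun y hy => by
    rw [hNx'] at hy; simp [degIn, hNT y hy]
  have h3 := mul_weight_le (R := insert x' (G.nbrsIn S v)) ihT hx'T (by simp)
    (show 4 ≤ #(G.nbrsIn S v) + 1 by change 4 ≤ G.degIn S v + 1; omega)
  have h4 : G.degIn T x' = 3 := by rw [degIn, hNx']; exact hdv
  have h5 : #(G.nbrsIn T x') = 3 := h4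
  rw [h4] at h1 h2
  rw [h5] at h2
  have q4 := invRate_pow_four
  norm_num at *
  linarith

lemma weight_lt_of_cubic (hG : G.CliqueFree 3) {S : Finset V}
    (ih : ∀ T ⊂ S, G.WeightBound T)
    (h3 : ∀ x ∈ S, G.degIn S x = 3 → ∀ y ∈ G.nbrsIn S x, G.degIn S y = 3) {v : V} (hv : v ∈ S)
    (hdv : G.degIn S v = 3) :
    G.weight S < 1 := by
  have q0 := invRate_pos
  have q1 := invRate_lt
  have q2 := invRate_sq_lt
  have q4 := invRate_pow_four
  have q5 := invRate_pow_add_four 1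
  have q6 := invRate_pow_add_four 2
  norm_num at q5 q6
  -- The direct estimate q + q^4 + 3q^6 slightly exceeds 1, so a small gain on S \ {v} is required;
  -- it comes from a second branching, at a vertex at distance two from v.
  suffices hH : G.weight (S \ {v}) ≤ 0.96 by
    have h1 := weight_le_branch_bounds hG ih hv (k := 3) fun x hx => (h3 v hv hdv x hx).ge
    rw [hdv] at h1
    norm_num at h1
    nlinarith
  obtain ⟨u, hu⟩ : (G.nbrsIn S v).Nonempty := card_pos.1 (by change 0 < G.degIn S v; omega)
  have hdu := h3 v hv hdv u hu
  obtain ⟨huS, hvu⟩ := mem_nbrsIn.1 hu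
  have hvu' : v ∈ G.nbrsIn S u := mem_nbrsIn.2 ⟨hv, hvu.symm⟩
  set H := S \ {v} with hH
  have hHS : H ⊂ S := sdiff_ssubset_of_mem hv (by simp)
  have ihH : ∀ T ⊂ H, G.WeightBound T := fun T hT => ih T (hT.trans hHS)
  obtain ⟨x, x', hxx', hxe⟩ := card_eq_two.1 (show #((G.nbrsIn S u).erase v) = 2 by
    rw [card_erase_of_mem hvu']; change G.degIn S u - 1 = 2; omega)
  have key : ∀ z ∈ (G.nbrsIn S u).erase v, z ∈ S ∧ z ≠ v ∧ G.Adj u z ∧ G.degIn S z = 3 ∧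
      G.nbrsIn H z = G.nbrsIn S z ∧ ∀ y ∈ G.nbrsIn S z, 2 ≤ G.degIn H y := fun z hz => by
    obtain ⟨hzv, hz⟩ := mem_erase.1 hz
    obtain ⟨hzS, huz⟩ := mem_nbrsIn.1 hz
    have hdz := h3 u huS hdu z hz
    refine ⟨hzS, hzv, huz, hdz,
      nbrsIn_sdiff_singleton (hG.not_adj_of_adj huz hvu.symm), fun y hy => ?_⟩
    have h1 := h3 z hzS hdz y hy
    have h2 := degIn_le_degIn_sdiff_singleton (G := G) S y v
    rw [← hH] at h2
    omega
  -- The cubic vertex u loses both v and z, hence has degree at most 1.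
  have leafu : ∀ z ∈ (G.nbrsIn S u).erase v, G.weight (H \ {z}) ≤ 0.79 := fun z hz => by
    obtain ⟨hzS, hzv, huz, -⟩ := key z hz
    have huH : u ∈ H := by simp [hH, huS, hvu.ne']
    have hzH : z ∈ H := by simp [hH, hzS, hzv]
    refine (ihH _ (sdiff_ssubset_of_mem hzH (by simp))).2 ⟨u, by simp [huH, huz.ne], ?_⟩
    have h1 := degIn_sdiff_add_one_le hvu' (mem_singleton_self v)
    have h2 := degIn_sdiff_add_one_le (S := H) (mem_nbrsIn.2 ⟨hzH, huz⟩) (mem_singleton_self z)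
    rw [← hH] at h1
    omega
  -- A neighbour y of z not adjacent to v keeps degree 3 in H, which gives 0.79q + q^4 + q^6 + 2q^5
  -- < 0.96. If no such pair exists, the component is K₃,₃.
  by_cases hfar : ∃ z ∈ (G.nbrsIn S u).erase v, ∃ y ∈ G.nbrsIn S z, ¬ G.Adj y v
  · obtain ⟨z, hz, y, hy, hyv⟩ := hfar
    have hleaf := leafu z hz
    obtain ⟨hzS, hzv, huz, hdz, hNz, hdeg⟩ := key z hz
    have hzH : z ∈ H := by simp [hH, hzS, hzv]
    have hdz' : G.degIn H z = 3 := by rw [degIn, hNz]; exact hdz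
    have h1 := weight_le_branch hG hzH
    have h2 := mul_weight_le (R := G.closedNbrsIn H z) ihH hzH (by simp) (le_refl 4)
    rw [hNz, ← add_sum_erase _ _ hy, hdz'] at h1
    have h4 := sum_pair_le ihH hzH (k := 2) ((G.nbrsIn S z).erase y)
      fun t ht => hdeg t (mem_of_mem_erase ht)
    rw [hdz', card_erase_of_mem hy, show #(G.nbrsIn S z) = 3 from hdz] at h4
    have hdy : G.degIn H y = 3 := by
      rw [degIn, nbrsIn_sdiff_singleton hyv]; exact h3 z hzS hdz y hy
    have h5 := mul_weight_le (R := G.closedNbrsIn H z ∪ G.closedNbrsIn H y) ihH hzH (by simp)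
      (show 6 ≤ 3 + G.degIn H y by omega)
    norm_num at *
    nlinarith
  · push Not at hfar
    have hNeq : ∀ z ∈ (G.nbrsIn S u).erase v, G.nbrsIn S z = G.nbrsIn S v := fun z hz => by
      refine eq_of_subset_of_card_le (fun y hy => mem_nbrsIn.2
        ⟨(mem_nbrsIn.1 hy).1, (hfar z hz y hy).symm⟩) ?_
      change G.degIn S v ≤ G.degIn S z
      rw [hdv, (key z hz).2.2.2.1]
    have hx : x ∈ (G.nbrsIn S u).erase v := by simp [hxe]
    have hx' : x' ∈ (G.nbrsIn S u).erase v := by simp [hxe]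
    obtain ⟨hxS, hxv, hux, hdx, hNx, hdeg⟩ := key x hx
    obtain ⟨hxS', hxv', -⟩ := key x' hx'
    have hxH : x ∈ H := by simp [hH, hxS, hxv]
    have h1 := weight_sdiff_le_of_complete_second_neighborhood hG ih hv hdv
      (h3 v hv hdv) hxS hxS' hxv hxv' hxx' (hNeq x hx) (hNeq x' hx')
    have h2 := weight_le_branch_bounds hG ihH hxH (k := 2) (by rwa [hNx])
    have h4 : G.degIn H x = 3 := by rw [degIn, hNx]; exact hdx
    rw [h4] at h2
    rw [← hH] at h1
    norm_num at *
    nlinarith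

/-! ### The 2-regular case and four-cycle components -/

/-- The vertices `a`, `b`, `c`, `d` form, in this cyclic order, a component of `G[S]` that is a
cycle on four vertices. -/
def IsFourCycleIn (G : SimpleGraph V) (S : Finset V) (a b c d : V) : Prop :=
  a ≠ c ∧ b ≠ d ∧ G.nbrsIn S a = {b, d} ∧ G.nbrsIn S b = {a, c} ∧ G.nbrsIn S c = {b, d} ∧
    G.nbrsIn S d = {a, c}

/-- Follow the path u', u, v, w, w'. If u' = w' it closes to a C₄. Otherwise each of the four
branches at v leaves a vertex of degree at most 1, so the bound is 0.79 (q + q^3 + 2q^4) < 1. -/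
lemma weight_lt_or_isFourCycleIn (hG : G.CliqueFree 3) {S : Finset V}
    (ih : ∀ T ⊂ S, G.WeightBound T) (h2 : ∀ x ∈ S, G.degIn S x = 2) {v : V} (hv : v ∈ S) :
    G.weight S < 1 ∨ ∃ a b c d, G.IsFourCycleIn S a b c d := by
  obtain ⟨u, w, huw, hNv⟩ := card_eq_two.1 (h2 v hv)
  have other : ∀ z ∈ G.nbrsIn S v, z ∈ S ∧ G.Adj v z ∧ ∃ z', z' ≠ v ∧ G.nbrsIn S z = {v, z'} :=
    fun z hz => by
      obtain ⟨hzS, hvz⟩ := mem_nbrsIn.1 hz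
      obtain ⟨s, t, hst, hN⟩ := card_eq_two.1 (h2 z hzS)
      have : v ∈ G.nbrsIn S z := mem_nbrsIn.2 ⟨hv, hvz.symm⟩
      rw [hN, mem_insert, mem_singleton] at this
      rcases this with rfl | rfl
      exacts [⟨hzS, hvz, t, hst.symm, hN⟩, ⟨hzS, hvz, s, hst, by rw [hN, pair_comm]⟩]
  obtain ⟨huS, hvu, u', hu'v, hNu⟩ := other u (by simp [hNv])
  obtain ⟨hwS, hvw, w', hw'v, hNw⟩ := other w (by simp [hNv])
  have hu' : u' ∈ S ∧ G.Adj u u' := mem_nbrsIn.1 (by simp [hNu])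
  have hw' : w' ∈ S ∧ G.Adj w w' := mem_nbrsIn.1 (by simp [hNw])
  have hvu' : ¬ G.Adj v u' := hG.not_adj_of_adj hvu.symm hu'.2
  have hvw' : ¬ G.Adj v w' := hG.not_adj_of_adj hvw.symm hw'.2
  have huw' : ¬ G.Adj u w := hG.not_adj_of_adj hvu hvw
  by_cases hne : u' = w'
  · subst hne
    refine .inr ⟨v, u, u', w, hu'v.symm, huw, hNv, hNu, ?_, hNw⟩
    refine (eq_of_subset_of_card_le ?_ ?_).symm
    · intro z hz
      simp only [mem_insert, mem_singleton] at hz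
      rcases hz with rfl | rfl
      exacts [mem_nbrsIn.2 ⟨huS, hu'.2.symm⟩, mem_nbrsIn.2 ⟨hwS, hw'.2.symm⟩]
    · rw [card_pair huw]
      exact (h2 u' hu'.1).le
  left
  have leaf : ∀ (R : Finset V) (x y : V), v ∈ R → x ∈ S → x ∉ R → y ∈ S → y ∈ R → G.Adj x y →
      G.weight (S \ R) ≤ 0.79 := fun R x y hvR hx hxR hy hyR hxy =>
    (ih _ (sdiff_ssubset_of_mem hv hvR)).2 ⟨x, mem_sdiff.2 ⟨hx, hxR⟩, by
      have := degIn_sdiff_add_one_le (mem_nbrsIn.2 ⟨hy, hxy⟩) hyR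
      have := h2 x hx
      omega⟩
  have huw2 : u' ≠ w := fun h => huw' (h ▸ hu'.2)
  have hwu2 : w' ≠ u := fun h => huw' (h ▸ hw'.2).symm
  have h1 := weight_le_branch hG hv
  rw [hNv, sum_pair huw, h2 v hv, h2 u huS, h2 w hwS] at h1
  have l1 := leaf {v} u v (by simp) huS (by simp [hvu.ne']) hv (by simp) hvu.symm
  have l2 := leaf (G.closedNbrsIn S v) u' u (by simp) hu'.1 (by simp [hu'v, hvu']) huS
    (by simp [huS, hvu]) hu'.2.symm
  have l3 := leaf (G.closedNbrsIn S v ∪ G.closedNbrsIn S u) w' w (by simp) hw'.1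
    (by simp only [closedNbrsIn, hNv, hNu, mem_union, mem_insert, mem_singleton]
        have := hw'.2.ne
        tauto) hwS (by simp [hwS, hvw]) hw'.2.symm
  have l4 := leaf (G.closedNbrsIn S v ∪ G.closedNbrsIn S w) u' u (by simp) hu'.1
    (by simp only [closedNbrsIn, hNv, hNw, mem_union, mem_insert, mem_singleton]
        have := hu'.2.ne
        tauto) huS (by simp [huS, hvu]) hu'.2.symm
  have q0 := invRate_pos
  have q1 := invRate_lt
  have q3 := invRate_pow_three_lt
  have q4 := invRate_pow_four
  have q3' : 0 < q ^ 3 := by positivity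
  norm_num at *
  nlinarith

/-- The inductive step: a nonempty graph has weight below `1` or a component `C₄`. -/
lemma weight_lt_or_exists_isFourCycleIn (hG : G.CliqueFree 3) {S : Finset V}
    (ih : ∀ T ⊂ S, G.WeightBound T) (hS : S.Nonempty) :
    G.weight S < 1 ∨ ∃ a b c d, G.IsFourCycleIn S a b c d := by
  by_cases hmin : ∃ u ∈ S, G.degIn S u ≤ 1
  · obtain ⟨u, hu, hdu⟩ := hmin
    exact .inl ((weight_le_of_degIn_le_one hG ih hu hdu).trans_lt (by norm_num))
  push Not at hmin
  by_cases h32 : ∃ v ∈ S, 3 ≤ G.degIn S v ∧ ∃ u ∈ G.nbrsIn S v, G.degIn S u = 2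
  · obtain ⟨v, hv, hdv, u, hu, hdu⟩ := h32
    exact .inl (weight_lt_of_degIn_two_neighbor hG ih hmin hv hdv hu hdu)
  have h33 : ∀ v ∈ S, 3 ≤ G.degIn S v → ∀ u ∈ G.nbrsIn S v, 3 ≤ G.degIn S u :=
    fun v hv hdv u hu => by
      have h1 := hmin u (mem_nbrsIn.1 hu).1
      have h2 : G.degIn S u ≠ 2 := fun h => h32 ⟨v, hv, hdv, u, hu, h⟩
      omega
  by_cases h4 : ∃ v ∈ S, 4 ≤ G.degIn S v
  · obtain ⟨v, hv, hdv⟩ := h4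
    exact .inl (weight_lt_of_degIn_ge_four hG ih hv hdv (h33 v hv (by omega)))
  push Not at h4
  by_cases h3 : ∃ v ∈ S, G.degIn S v = 3
  · obtain ⟨v, hv, hdv⟩ := h3
    refine .inl (weight_lt_of_cubic hG ih (fun x hx hdx y hy => ?_) hv hdv)
    have h5 := h33 x hx hdx.ge y hy
    have h6 := h4 y (mem_nbrsIn.1 hy).1
    omega
  push Not at h3
  obtain ⟨v, hv⟩ := hS
  refine weight_lt_or_isFourCycleIn hG ih (fun x hx => ?_) hv
  have h5 := hmin x hx
  have h6 := h4 x hx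
  have h7 := h3 x hx
  omega

namespace IsFourCycleIn

variable {S : Finset V} {a b c d : V}

/-- Lets facts proved at `a` be reused at the other three vertices. -/
lemma rotate (h : G.IsFourCycleIn S a b c d) : G.IsFourCycleIn S b c d a := by
  obtain ⟨h1, h2, h3, h4, h5, h6⟩ := h
  exact ⟨h2, h1.symm, by rw [h4, pair_comm], by rw [h5], by rw [h6, pair_comm], by rw [h3]⟩

lemma adj_iff (h : G.IsFourCycleIn S a b c d) {x : V} (hx : x ∈ S) :
    G.Adj a x ↔ x = b ∨ x = d := by
  have := congrArg (x ∈ ·) h.2.2.1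
  simpa [hx] using this

lemma mem (h : G.IsFourCycleIn S a b c d) : a ∈ S ∧ G.Adj b a :=
  mem_nbrsIn.1 (by simp [h.2.2.2.1])

lemma subset (h : G.IsFourCycleIn S a b c d) : {a, b, c, d} ⊆ S := by
  intro x hx
  simp only [mem_insert, mem_singleton] at hx
  rcases hx with rfl | rfl | rfl | rfl
  exacts [h.mem.1, h.rotate.mem.1, h.rotate.rotate.mem.1, h.rotate.rotate.rotate.mem.1]

lemma card_eq (h : G.IsFourCycleIn S a b c d) : #({a, b, c, d} : Finset V) = 4 := by
  have h1 := h.mem.2.ne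
  have h2 := h.rotate.mem.2.ne
  have h3 := h.rotate.rotate.mem.2.ne
  have h4 := h.rotate.rotate.rotate.mem.2.ne
  have h5 := h.1
  have h6 := h.2.1
  rw [card_insert_of_notMem, card_insert_of_notMem, card_pair h3.symm]
  · simp [h2.symm, h6]
  · simp [h1.symm, h5, h4]

lemma mem_of_adj (h : G.IsFourCycleIn S a b c d) {x y : V} (hx : x ∈ ({a, b, c, d} : Finset V))
    (hy : y ∈ S) (hxy : G.Adj x y) : y ∈ ({a, b, c, d} : Finset V) := by
  simp only [mem_insert, mem_singleton] at hx ⊢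
  rcases hx with rfl | rfl | rfl | rfl
  · have := (h.adj_iff hy).1 hxy; tauto
  · have := (h.rotate.adj_iff hy).1 hxy; tauto
  · have := (h.rotate.rotate.adj_iff hy).1 hxy; tauto
  · have := (h.rotate.rotate.rotate.adj_iff hy).1 hxy; tauto

lemma not_mem_of_dissoc (h : G.IsFourCycleIn S a b c d) {F : Finset V} (hF : G.Dissoc F)
    (ha : a ∈ F) (hb : b ∈ F) : d ∉ F := fun hd =>
  h.2.1 (card_le_one.1 (hF a ha) b
    (mem_nbrsIn.2 ⟨hb, (h.adj_iff h.rotate.mem.1).2 (.inl rfl)⟩) d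
    (mem_nbrsIn.2 ⟨hd, (h.adj_iff h.rotate.rotate.rotate.mem.1).2 (.inr rfl)⟩))

/-- Any three vertices of C₄ contain a vertex together with both of its neighbours. -/
lemma card_le_two_of_dissoc (h : G.IsFourCycleIn S a b c d) {F : Finset V} (hF : G.Dissoc F)
    (hFR : F ⊆ {a, b, c, d}) : #F ≤ 2 := by
  have h1 := h.not_mem_of_dissoc hF
  have h2 := h.rotate.not_mem_of_dissoc hF
  have h3 := h.rotate.rotate.not_mem_of_dissoc hF
  have h4 := h.rotate.rotate.rotate.not_mem_of_dissoc hF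
  have hpair : ∃ x y, F ⊆ {x, y} := by
    have key : ∀ x y, (∀ z ∈ ({a, b, c, d} : Finset V), z ∈ F → z = x ∨ z = y) → F ⊆ {x, y} :=
      fun x y hxy z hz => by simpa using hxy z (hFR hz) hz
    simp only [mem_insert, mem_singleton, forall_eq_or_imp, forall_eq] at key
    by_cases ha : a ∈ F
    · by_cases hc : c ∈ F
      · have hb : b ∉ F := fun hb => h2 hb hc ha
        have hd : d ∉ F := fun hd => h4 hd ha hc
        exact ⟨a, c, key _ _ (by simp [hb, hd])⟩
      · by_cases hb : b ∈ F
        · exact ⟨a, b, key _ _ (by simp [hc, h1 ha hb])⟩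
        · exact ⟨a, d, key _ _ (by simp [hc, hb])⟩
    · by_cases hb : b ∈ F
      · by_cases hc : c ∈ F
        · have hd : d ∉ F := fun hd => h3 hc hd hb
          exact ⟨b, c, key _ _ (by simp [ha, hd])⟩
        · exact ⟨b, d, key _ _ (by simp [ha, hc])⟩
      · exact ⟨c, d, key _ _ (by simp [ha, hb])⟩
  obtain ⟨x, y, hxy⟩ := hpair
  exact (card_le_card hxy).trans card_le_two

lemma _root_.SimpleGraph.dissoc_of_card_le_two {F : Finset V} (hF : #F ≤ 2) : G.Dissoc F := by
  intro v hv
  have : G.nbrsIn F v ⊆ F.erase v := fun x hx => by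
    obtain ⟨hx, hvx⟩ := mem_nbrsIn.1 hx
    exact mem_erase.2 ⟨hvx.ne', hx⟩
  have h2 := card_le_card this
  rw [card_erase_of_mem hv] at h2
  change G.degIn F v ≤ _ at h2
  omega

/-- The maximal dissociation sets of C₄ are exactly the pairs of vertices, and there are 6 of them.
-/
lemma card_mdsIn (h : G.IsFourCycleIn S a b c d) :
    #(G.mdsIn ({a, b, c, d} : Finset V)) = 6 := by
  have : G.mdsIn ({a, b, c, d} : Finset V) = powersetCard 2 {a, b, c, d} := by
    ext F
    rw [mem_mdsIn, mem_powersetCard]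
    refine and_congr_right fun hFR => ⟨fun ⟨hd, hmax⟩ => ?_, fun h2 => ⟨?_, fun y hy hyF hd => ?_⟩⟩
    · refine le_antisymm (h.card_le_two_of_dissoc hd hFR) ?_
      by_contra hlt
      obtain ⟨y, hy, hyF⟩ := exists_mem_notMem_of_card_lt_card
        (show #F < #({a, b, c, d} : Finset V) by rw [h.card_eq]; omega)
      refine hmax y hy hyF (dissoc_of_card_le_two ?_)
      rw [card_insert_of_notMem hyF]
      omega
    · exact dissoc_of_card_le_two h2.le
    · have := h.card_le_two_of_dissoc hd (insert_subset hy hFR)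
      rw [card_insert_of_notMem hyF] at this
      omega
  rw [this, card_powersetCard, h.card_eq]
  rfl

lemma weight_eq (h : G.IsFourCycleIn S a b c d) :
    G.weight S = G.weight (S \ {a, b, c, d}) := by
  rw [weight_mul h.subset fun x hx y hy hxy =>
    (mem_sdiff.1 hy).2 (h.mem_of_adj hx (mem_sdiff.1 hy).1 hxy)]
  have : G.weight ({a, b, c, d} : Finset V) = 1 := by
    rw [weight, h.card_mdsIn, h.card_eq, invRate_pow_four]; norm_num
  rw [this, one_mul]

lemma sdiff_ssubset (h : G.IsFourCycleIn S a b c d) : S \ {a, b, c, d} ⊂ S :=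
  sdiff_ssubset_of_mem h.mem.1 (by simp)

lemma adj_cycle_iff (h : G.IsFourCycleIn S a b c d) (i j : Fin 4) :
    G.Adj (![a, b, c, d] i) (![a, b, c, d] j) ↔ (cycleGraph 4).Adj i j := by
  -- In `Fin 4`, adding 3 is subtracting 1.
  have hc : (cycleGraph 4).Adj i j ↔ j = i + 1 ∨ j = i + 3 := by revert i j; decide
  have n1 := h.mem.2.ne
  have n2 := h.rotate.mem.2.ne
  have n3 := h.rotate.rotate.mem.2.ne
  have n4 := h.rotate.rotate.rotate.mem.2.ne
  have n5 := h.1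
  have n6 := h.2.1
  have m1 := h.mem.1
  have m2 := h.rotate.mem.1
  have m3 := h.rotate.rotate.mem.1
  have m4 := h.rotate.rotate.rotate.mem.1
  have a1 := fun x (hx : x ∈ S) => h.adj_iff hx
  have a2 := fun x (hx : x ∈ S) => h.rotate.adj_iff hx
  have a3 := fun x (hx : x ∈ S) => h.rotate.rotate.adj_iff hx
  have a4 := fun x (hx : x ∈ S) => h.rotate.rotate.rotate.adj_iff hx
  rw [hc]
  fin_cases i <;> fin_cases j <;>
    simp [a1, a2, a3, a4, m1, m2, m3, m4, n1, n2, n3, n4, n5, n6, n1.symm, n2.symm, n3.symm,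
      n4.symm, n5.symm, n6.symm]

end IsFourCycleIn

lemma weight_empty : G.weight ∅ = 1 := by
  have : G.mdsIn ∅ = {∅} := by
    ext F
    simp only [mem_mdsIn, subset_empty, mem_singleton, notMem_empty, false_imp_iff, implies_true,
      and_true, and_iff_left_iff_imp]
    rintro rfl v hv
    simp at hv
  simp [weight, this]

theorem weightBound (hG : G.CliqueFree 3) (S : Finset V) : G.WeightBound S := by
  induction S using Finset.strongInduction with
  | H S ih =>
    refine ⟨?_, fun ⟨u, hu, hdu⟩ => weight_le_of_degIn_le_one hG ih hu hdu⟩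
    rcases S.eq_empty_or_nonempty with rfl | hS
    · exact weight_empty.le
    · rcases weight_lt_or_exists_isFourCycleIn hG ih hS with h | ⟨a, b, c, d, h⟩
      · exact h.le
      · rw [h.weight_eq]
        exact (ih _ h.sdiff_ssubset).1

/-! ### Disjoint unions of four-cycles and the equality case -/

/-- `G[S]` is a disjoint union of `k` cycles on four vertices. -/
def IsFourCycleUnion (G : SimpleGraph V) (k : ℕ) (S : Finset V) : Prop :=
  ∃ f : Fin k × Fin 4 → V, Function.Injective f ∧ (∀ x, x ∈ S ↔ ∃ p, f p = x) ∧
    ∀ p r, G.Adj (f p) (f r) ↔ (disjointCopies k (cycleGraph 4)).Adj p r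

lemma IsFourCycleIn.isFourCycleUnion_succ {S : Finset V} {a b c d : V}
    (h : G.IsFourCycleIn S a b c d) {k : ℕ} (hk : G.IsFourCycleUnion k (S \ {a, b, c, d})) :
    G.IsFourCycleUnion (k + 1) S := by
  obtain ⟨f, hf, hS, hadj⟩ := hk
  have hg : ∀ j, ![a, b, c, d] j ∈ ({a, b, c, d} : Finset V) := fun j => by fin_cases j <;> simp
  have hfS : ∀ p, f p ∈ S \ {a, b, c, d} := fun p => (hS _).2 ⟨p, rfl⟩
  have hne : ∀ j p, ¬ G.Adj (![a, b, c, d] j) (f p) := fun j p hjp =>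
    (mem_sdiff.1 (hfS p)).2 (h.mem_of_adj (hg j) (mem_sdiff.1 (hfS p)).1 hjp)
  -- The new cycle becomes copy 0 and the old copies shift up by one.
  refine ⟨fun p => Fin.cases (![a, b, c, d] p.2) (fun i => f (i, p.2)) p.1, ?_, fun x => ?_, ?_⟩
  · rintro ⟨i, j⟩ ⟨i', j'⟩ hij
    have hinj : Function.Injective ![a, b, c, d] := by
      have : Finset.image ![a, b, c, d] univ = {a, b, c, d} := by
        ext x; simp [Fin.exists_fin_succ, eq_comm]
      rw [← Set.injOn_univ, ← coe_univ, ← card_image_iff, this, h.card_eq]; rfl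
    induction i using Fin.cases with
    | zero =>
      induction i' using Fin.cases with
      | zero => simp only [Fin.cases_zero] at hij; rw [hinj hij]
      | succ i' =>
        simp only [Fin.cases_zero, Fin.cases_succ] at hij
        exact absurd (hij ▸ hg j) (mem_sdiff.1 (hfS _)).2
    | succ i =>
      induction i' using Fin.cases with
      | zero =>
        simp only [Fin.cases_zero, Fin.cases_succ] at hij
        exact absurd (hij ▸ hg j') (mem_sdiff.1 (hfS _)).2
      | succ i' =>
        simp only [Fin.cases_succ] at hij
        have := hf hij
        simp only [Prod.mk.injEq] at this ⊢
        exact ⟨by rw [this.1], this.2⟩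
  · constructor
    · intro hx
      by_cases hxR : x ∈ ({a, b, c, d} : Finset V)
      · simp only [mem_insert, mem_singleton] at hxR
        rcases hxR with rfl | rfl | rfl | rfl
        exacts [⟨(0, 0), rfl⟩, ⟨(0, 1), rfl⟩, ⟨(0, 2), rfl⟩, ⟨(0, 3), rfl⟩]
      · obtain ⟨⟨i, j⟩, hp⟩ := (hS x).1 (mem_sdiff.2 ⟨hx, hxR⟩)
        exact ⟨(i.succ, j), by simpa using hp⟩
    · rintro ⟨⟨i, j⟩, rfl⟩
      induction i using Fin.cases with
      | zero => exact h.subset (hg j)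
      | succ i => exact (mem_sdiff.1 (hfS (i, j))).1
  · rintro ⟨i, j⟩ ⟨i', j'⟩
    induction i using Fin.cases with
    | zero =>
      induction i' using Fin.cases with
      | zero => simpa [disjointCopies] using h.adj_cycle_iff j j'
      | succ i' =>
        simpa [disjointCopies, (Fin.succ_ne_zero i').symm] using hne j (i', j')
    | succ i =>
      induction i' using Fin.cases with
      | zero =>
        simpa [disjointCopies, adj_comm] using hne j' (i, j)
      | succ i' => simpa [disjointCopies] using hadj (i, j) (i', j')

lemma IsFourCycleUnion.exists_isFourCycleIn {k : ℕ} {S : Finset V}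
    (h : G.IsFourCycleUnion (k + 1) S) :
    ∃ a b c d, G.IsFourCycleIn S a b c d ∧ G.IsFourCycleUnion k (S \ {a, b, c, d}) := by
  obtain ⟨f, hf, hS, hadj⟩ := h
  have hN : ∀ j, G.nbrsIn S (f (0, j)) = {f (0, j + 1), f (0, j + 3)} := fun j => by
    have hc : ∀ j i : Fin 4, (cycleGraph 4).Adj j i ↔ i = j + 1 ∨ i = j + 3 := by decide
    ext x
    simp only [mem_nbrsIn, mem_insert, mem_singleton]
    constructor
    · rintro ⟨hx, hjx⟩
      obtain ⟨⟨i, j'⟩, rfl⟩ := (hS x).1 hx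
      obtain ⟨h1, h2⟩ := (hadj _ _).1 hjx
      simp only at h1 h2
      subst h1
      rcases (hc _ _).1 h2 with rfl | rfl
      exacts [.inl rfl, .inr rfl]
    · rintro (rfl | rfl)
      exacts [⟨(hS _).2 ⟨_, rfl⟩, (hadj _ _).2 ⟨rfl, (hc _ _).2 (.inl rfl)⟩⟩,
        ⟨(hS _).2 ⟨_, rfl⟩, (hadj _ _).2 ⟨rfl, (hc _ _).2 (.inr rfl)⟩⟩]
  refine ⟨f (0, 0), f (0, 1), f (0, 2), f (0, 3),
    ⟨hf.ne (by simp), hf.ne (by simp), hN 0, ?_, ?_, hN 3 |>.trans (pair_comm _ _) |>.trans ?_⟩,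
    fun p => f (p.1.succ, p.2), ?_, fun x => ?_, ?_⟩
  · exact (hN 1).trans (pair_comm _ _)
  · exact (hN 2).trans (pair_comm _ _)
  · exact pair_comm _ _
  · rintro ⟨i, j⟩ ⟨i', j'⟩ hij
    simpa using hf hij
  · constructor
    · intro hx
      obtain ⟨hx, hxR⟩ := mem_sdiff.1 hx
      obtain ⟨⟨i, j⟩, rfl⟩ := (hS x).1 hx
      induction i using Fin.cases with
      | zero => exact absurd (by fin_cases j <;> simp) hxR
      | succ i => exact ⟨(i, j), rfl⟩
    · rintro ⟨⟨i, j⟩, rfl⟩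
      refine mem_sdiff.2 ⟨(hS _).2 ⟨_, rfl⟩, fun hx => ?_⟩
      simp [hf.eq_iff] at hx
  · rintro ⟨i, j⟩ ⟨i', j'⟩
    simpa [disjointCopies] using hadj (i.succ, j) (i'.succ, j')

lemma IsFourCycleUnion.weight_eq_one {k : ℕ} : ∀ {S : Finset V}, G.IsFourCycleUnion k S →
    G.weight S = 1 := by
  induction k with
  | zero =>
    rintro S ⟨f, -, hS, -⟩
    have : S = ∅ := eq_empty_of_forall_notMem fun x hx => by
      obtain ⟨⟨i, -⟩, -⟩ := (hS x).1 hx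
      exact i.elim0
    rw [this, weight_empty]
  | succ k ih =>
    intro S h
    obtain ⟨a, b, c, d, h1, h2⟩ := h.exists_isFourCycleIn
    rw [h1.weight_eq, ih h2]

lemma IsFourCycleUnion.card_eq {k : ℕ} {S : Finset V} (h : G.IsFourCycleUnion k S) :
    #S = 4 * k := by
  obtain ⟨f, hf, hS, -⟩ := h
  have : S = univ.image f := by ext x; simp [hS]
  rw [this, card_image_of_injective _ hf]
  simp [mul_comm]

/-- Weight 1 rules out the strict alternative, so there is a C₄ component; removing it keeps the
weight at 1. -/
theorem exists_isFourCycleUnion_of_weight_eq_one (hG : G.CliqueFree 3) (S : Finset V)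
    (hS : G.weight S = 1) : ∃ k, G.IsFourCycleUnion k S := by
  induction S using Finset.strongInduction with
  | H S ih =>
    rcases S.eq_empty_or_nonempty with rfl | hne
    · exact ⟨0, fun p => p.1.elim0, fun p => p.1.elim0, by simp, fun p => p.1.elim0⟩
    · rcases weight_lt_or_exists_isFourCycleIn hG (fun T _ => weightBound hG T) hne with
        h | ⟨a, b, c, d, h⟩
      · exact absurd hS h.ne
      · obtain ⟨k, hk⟩ := ih _ h.sdiff_ssubset (by rw [← h.weight_eq, hS])
        exact ⟨k + 1, h.isFourCycleUnion_succ hk⟩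

/-! ### Transfer to sets and the final theorem -/

lemma isDissociationSet_coe (F : Finset V) : G.IsDissociationSet (F : Set V) ↔ G.Dissoc F := by
  have key : ∀ v : (F : Set V), ((G.induce (F : Set V)).neighborSet v).encard = G.degIn F v :=
    fun v => by
      rw [← Subtype.val_injective.encard_image, degIn, ← Set.encard_coe_eq_coe_finsetCard]
      congr 1
      ext x
      simp [and_comm]
  simp only [IsDissociationSet, key, Nat.cast_le_one, Dissoc]
  exact ⟨fun h v hv => h ⟨v, hv⟩, fun h v => h v v.2⟩

lemma numMaximalDissociationSets_eq [Fintype V] :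
    G.numMaximalDissociationSets = #(G.mdsIn univ) := by
  have : G.maximalDissociationSets = (fun F : Finset V => (F : Set V)) '' G.mdsIn univ := by
    ext F
    lift F to Finset V using F.toFinite
    -- Being hereditary, the property allows maximality to be tested on one-vertex extensions, as in
    -- `mdsIn`.
    have hmono : ∀ ⦃s t : Set V⦄, G.IsDissociationSet t → s ⊆ t → G.IsDissociationSet s := by
      intro s t ht hst
      lift s to Finset V using s.toFinite
      lift t to Finset V using t.toFinite
      rw [isDissociationSet_coe] at ht ⊢
      exact ht.mono (coe_subset.1 hst)
    simp only [maximalDissociationSets, Set.mem_ofPred_eq, Set.maximal_iff_forall_insert hmono,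
      ← coe_insert, isDissociationSet_coe, Set.mem_image, coe_inj, exists_eq_right, mem_coe,
      mem_mdsIn, subset_univ, mem_univ, true_and, true_imp_iff]
  rw [numMaximalDissociationSets, this, Set.ncard_image_of_injective _ coe_injective,
    Set.ncard_coe_finset]

lemma isFourCycleUnion_univ_iff [Fintype V] {k : ℕ} :
    G.IsFourCycleUnion k univ ↔ Nonempty (G ≃g disjointCopies k (cycleGraph 4)) := by
  constructor
  · rintro ⟨f, hf, hS, hadj⟩
    exact ⟨(RelIso.mk (Equiv.ofBijective f ⟨hf, fun x => (hS x).1 (mem_univ x)⟩)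
      (hadj _ _)).symm⟩
  · rintro ⟨e⟩
    exact ⟨e.symm, e.symm.injective, fun x => ⟨fun _ => ⟨e x, by simp⟩, fun _ => mem_univ x⟩,
      fun p r => e.symm.map_adj_iff⟩

end Extremal

end SimpleGraph

theorem theorem1p2 {V : Type*} [Fintype V] (G : SimpleGraph V) (n : ℕ)
    (hn : Fintype.card V = n) (hG : G.CliqueFree 3) :
    (G.numMaximalDissociationSets : ℝ) ≤ (6 : ℝ) ^ ((n : ℝ) / 4) ∧
      ((G.numMaximalDissociationSets : ℝ) = (6 : ℝ) ^ ((n : ℝ) / 4) ↔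
        4 ∣ n ∧
          Nonempty (G ≃g SimpleGraph.disjointCopies (n / 4) (SimpleGraph.cycleGraph 4))) := by
  have hq : SimpleGraph.invRate ^ n = ((6 : ℝ) ^ ((n : ℝ) / 4))⁻¹ := by
    rw [SimpleGraph.invRate, ← Real.rpow_natCast, ← Real.rpow_mul (by norm_num),
      ← Real.rpow_neg (by norm_num)]
    congr 1
    ring
  have hw : G.weight Finset.univ =
      (G.numMaximalDissociationSets : ℝ) / (6 : ℝ) ^ ((n : ℝ) / 4) := by
    rw [SimpleGraph.weight, Finset.card_univ, hn, hq, SimpleGraph.numMaximalDissociationSets_eq]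
    exact (div_eq_mul_inv _ _).symm
  have hpos : (0 : ℝ) < (6 : ℝ) ^ ((n : ℝ) / 4) := Real.rpow_pos_of_pos (by norm_num) _
  refine ⟨?_, ?_⟩
  · have := (SimpleGraph.weightBound hG Finset.univ).1
    rwa [hw, div_le_one hpos] at this
  · rw [← div_eq_one_iff_eq hpos.ne', ← hw, ← SimpleGraph.isFourCycleUnion_univ_iff]
    refine ⟨fun h => ?_, fun h => h.2.weight_eq_one⟩
    obtain ⟨k, hk⟩ := SimpleGraph.exists_isFourCycleUnion_of_weight_eq_one hG _ h
    have hcard := hk.card_eq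
    rw [Finset.card_univ, hn] at hcard
    subst hcard
    exact ⟨⟨k, rfl⟩, by rwa [Nat.mul_div_cancel_left k (by norm_num)]⟩
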